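/- Let $a,b$ be the following $4\times 4$ matrices over the field $\mathbb{F}_3$ (dots stand for zeros): $$ a=\begin{pmatrix}.&1&.&.\\ .&.&1&.\\ .&.&.&1\\ -1&-1&-1&-1\end{pmatrix},\qquad b=\begin{pmatrix}1&.&.&.\\ .&.&1&.\\ -1&-1&-1&-1\\ .&1&.&.\end{pmatrix}. $$ Put $c_1=b$, $c_2=b^3$, $c_3=b^2$, $c_4=-b^2$, $d=(1,0,0,0)\in\mathbb{F}_3^4$, and consider the $17\times 17$ matrices over $\mathbb{F}_3$, in block form with diagonal blocks of sizes $1,4,4,4,4$, $$ A=\operatorname{diag}(1,a,a,a,a),\qquad B=\operatorname{diag}(1,b,b,b,b), $$ $$ C=\left(\begin{array}{c|cccc}1&.&.&.&.\\ \hline .&1&c_1&c_3&.\\ .&.&1&.&c_4\\ .&.&.&1&c_2\\ .&.&.&.&1\end{array}\right),\qquad D=\left(\begin{array}{c|cccc}1&d&.&.&.\\ \hline .&1&.&.&.\\ .&.&1&.&.\\ .&.&.&1&.\\ .&.&.&.&1\end{array}\right). $$ Let $G=\langle A,B,C,D\rangle\le \mathrm{GL}_{17}(\mathbb{F}_3)$,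 let $P$ be the normal closure of $\{C,D\}$ in $G$, and let $F=\langle A,B\rangle$. Then: 1. $G$ is solvable, $|G|=2^2\cdot 3^{24}\cdot 5$, and $G$ is isospectral to $S_4(3)=\mathrm{PSp}_4(3)$, i.e. the set of orders of elements of $G$ equals the set of orders of elements of $\mathrm{PSp}_4(3)$. The elements of the latter set that are maximal with respect to divisibility are exactly $5$, $9$ and $12$. 2. $G$ is the (internal) semidirect product $P\rtimes F$, where $P$ is the largest normal $3$-subgroup of $G$, has exponent $9$ and order $3^{24}$, and $F$ is a Frobenius group of shape $5:4$ with kernel $\langle A\rangle$ of order $5$ and complement $\langle B\rangle$ of order $4$. -/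

import Mathlib

namespace SolvIso

open Matrix

/-! ### Element orders -/

/-- The spectrum `ω(G)` of a (finite) group: the set of its element orders. -/
def elementOrders (G : Type*) [Group G] : Set ℕ := {n | ∃ g : G, orderOf g = n}

/-- The set `μ(G)` of those element orders that are maximal with respect to divisibility. -/
def maxElementOrders (G : Type*) [Group G] : Set ℕ :=
  {n | n ∈ elementOrders G ∧ ∀ m ∈ elementOrders G, n ∣ m → m = n}

/-- Two groups are isospectral if they have the same set of element orders. -/
def Isospectral (G H : Type*) [Group G] [Group H] : Prop := elementOrders G = elementOrders H

/-- The group `S₄(3) = PSp₄(3)`: the symplectic group of `4 × 4` matrices over `𝔽₃`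
modulo its center. -/
abbrev S43 : Type :=
  Matrix.symplecticGroup (Fin 2) (ZMod 3) ⧸
    Subgroup.center (Matrix.symplecticGroup (Fin 2) (ZMod 3))

/-- `Γ` is a Frobenius group with kernel `K` and complement `H`: it is the semidirect product of
its nontrivial normal subgroup `K` by its nontrivial subgroup `H`, and no nontrivial element of `H`
centralizes a nontrivial element of `K`. -/
structure IsFrobenius {Γ : Type*} [Group Γ] (K H : Subgroup Γ) : Prop where
  normal : K.Normal
  isComplement : Subgroup.IsComplement' K H
  kernel_ne_bot : K ≠ ⊥
  complement_ne_bot : H ≠ ⊥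
  fixedPointFree : ∀ h ∈ H, h ≠ 1 → ∀ k ∈ K, h * k = k * h → k = 1

/-! ### The matrices -/

/-- `4 × 4` matrices over `𝔽₃`. -/
abbrev M4 : Type := Matrix (Fin 4) (Fin 4) (ZMod 3)

/-- The generator `a` of order `5`. -/
def a : M4 :=
  !![ 0,  1,  0,  0;
      0,  0,  1,  0;
      0,  0,  0,  1;
     -1, -1, -1, -1]

/-- The generator `b` of order `4`. -/
def b : M4 :=
  !![ 1,  0,  0,  0;
      0,  0,  1,  0;
     -1, -1, -1, -1;
      0,  1,  0,  0]

/-- The `17` row and column indices: one single index, followed by four blocks of length four. -/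
abbrev Idx : Type := Fin 1 ⊕ Fin 4 × Fin 4

/-- The `17 × 17` matrix with `1` in the top left corner, zeros below it, first row completed by the
four row vectors `r 0, …, r 3` of length `4`, and lower right part the `4 × 4` block matrix `X` with
`4 × 4` blocks. -/
def blockMat (r : Fin 4 → Fin 4 → ZMod 3) (X : Matrix (Fin 4) (Fin 4) M4) :
    Matrix Idx Idx (ZMod 3) :=
  Matrix.fromBlocks 1 (Matrix.of fun _ p => r p.1 p.2) 0 (Matrix.compRingEquiv (Fin 4) (Fin 4) _ X)

/-- `diag(1, a, a, a, a)`. -/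
def matA : Matrix Idx Idx (ZMod 3) := blockMat 0 (Matrix.diagonal fun _ => a)

/-- `diag(1, b, b, b, b)`. -/
def matB : Matrix Idx Idx (ZMod 3) := blockMat 0 (Matrix.diagonal fun _ => b)

def c1 : M4 := b
def c2 : M4 := b ^ 3
def c3 : M4 := b ^ 2
def c4 : M4 := -b ^ 2

/-- The block matrix `C`. -/
def matC : Matrix Idx Idx (ZMod 3) :=
  blockMat 0
    !![1, c1, c3, 0;
       0, 1, 0, c4;
       0, 0, 1, c2;
       0, 0, 0, 1]

/-- The row vector `d`. -/
def d : Fin 4 → ZMod 3 := ![1, 0, 0, 0]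

/-- The block matrix `D`. -/
def matD : Matrix Idx Idx (ZMod 3) := blockMat ![d, 0, 0, 0] 1

/-! ### Invertibility of the four matrices -/

theorem blockMat_zero_mul (X Y : Matrix (Fin 4) (Fin 4) M4) :
    blockMat 0 X * blockMat 0 Y = blockMat 0 (X * Y) := by
  have h : (Matrix.of fun (_ : Fin 1) (p : Fin 4 × Fin 4) =>
      (0 : Fin 4 → Fin 4 → ZMod 3) p.1 p.2) = 0 := rfl
  simp only [blockMat, Matrix.fromBlocks_multiply, h, map_mul]
  simp

theorem blockMat_row_mul (r s : Fin 4 → Fin 4 → ZMod 3) :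
    blockMat r 1 * blockMat s 1 = blockMat (r + s) 1 := by
  simp only [blockMat, Matrix.fromBlocks_multiply, map_one]
  simp only [Matrix.mul_one, Matrix.one_mul, Matrix.mul_zero, Matrix.zero_mul, add_zero, zero_add]
  congr 1
  ext i p
  simp [add_comm]

theorem blockMat_zero_one : blockMat 0 1 = 1 := by
  have h : (Matrix.of fun (_ : Fin 1) (p : Fin 4 × Fin 4) =>
      (0 : Fin 4 → Fin 4 → ZMod 3) p.1 p.2) = 0 := rfl
  simp only [blockMat, h, map_one, Matrix.fromBlocks_one]

theorem a_pow : a ^ 5 = 1 := by decide +kernel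

theorem b_pow : b ^ 4 = 1 := by decide +kernel

/-- The inverse of the lower right part of `C`. -/
def lowerCInv : Matrix (Fin 4) (Fin 4) M4 :=
  !![1, -c1, -c3, c1 * c4 + c3 * c2;
     0, 1, 0, -c4;
     0, 0, 1, -c2;
     0, 0, 0, 1]

/-- `A` as an invertible matrix. -/
def uA : GL Idx (ZMod 3) where
  val := matA
  inv := blockMat 0 (Matrix.diagonal fun _ => a ^ 4)
  val_inv := by
    rw [matA, blockMat_zero_mul, Matrix.diagonal_mul_diagonal, ← blockMat_zero_one]
    simp only [← pow_succ', Nat.reduceAdd, a_pow, Matrix.diagonal_one]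
  inv_val := by
    rw [matA, blockMat_zero_mul, Matrix.diagonal_mul_diagonal, ← blockMat_zero_one]
    simp only [← pow_succ, Nat.reduceAdd, a_pow, Matrix.diagonal_one]

/-- `B` as an invertible matrix. -/
def uB : GL Idx (ZMod 3) where
  val := matB
  inv := blockMat 0 (Matrix.diagonal fun _ => b ^ 3)
  val_inv := by
    rw [matB, blockMat_zero_mul, Matrix.diagonal_mul_diagonal, ← blockMat_zero_one]
    simp only [← pow_succ', Nat.reduceAdd, b_pow, Matrix.diagonal_one]
  inv_val := by
    rw [matB, blockMat_zero_mul, Matrix.diagonal_mul_diagonal, ← blockMat_zero_one]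
    simp only [← pow_succ, Nat.reduceAdd, b_pow, Matrix.diagonal_one]

/-- `C` as an invertible matrix. -/
def uC : GL Idx (ZMod 3) where
  val := matC
  inv := blockMat 0 lowerCInv
  val_inv := by
    rw [matC, blockMat_zero_mul, ← blockMat_zero_one, lowerCInv]
    congr 1
    ext1 i j
    fin_cases i <;> fin_cases j <;> simp [Matrix.mul_apply, Fin.sum_univ_four]
  inv_val := by
    rw [matC, blockMat_zero_mul, ← blockMat_zero_one, lowerCInv]
    congr 1
    ext1 i j
    fin_cases i <;> fin_cases j <;> simp [Matrix.mul_apply, Fin.sum_univ_four]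
    abel

/-- `D` as an invertible matrix. -/
def uD : GL Idx (ZMod 3) where
  val := matD
  inv := blockMat (-![d, 0, 0, 0]) 1
  val_inv := by
    rw [matD, blockMat_row_mul, add_neg_cancel, blockMat_zero_one]
  inv_val := by
    rw [matD, blockMat_row_mul, neg_add_cancel, blockMat_zero_one]

/-! ### The group -/

/-- The group `G = ⟨A, B, C, D⟩`. -/
def G : Subgroup (GL Idx (ZMod 3)) := Subgroup.closure {uA, uB, uC, uD}

/-- The generator `A` as an element of `G`. -/
def gA : G := ⟨uA, Subgroup.subset_closure (by simp)⟩

/-- The generator `B` as an element of `G`. -/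
def gB : G := ⟨uB, Subgroup.subset_closure (by simp)⟩

/-- The generator `C` as an element of `G`. -/
def gC : G := ⟨uC, Subgroup.subset_closure (by simp)⟩

/-- The generator `D` as an element of `G`. -/
def gD : G := ⟨uD, Subgroup.subset_closure (by simp)⟩

/-- `P = ⟨C, D⟩^G`, the normal closure of `{C, D}` in `G`. -/
def P : Subgroup G := Subgroup.normalClosure {gC, gD}

/-- `F = ⟨A, B⟩`. -/
def F : Subgroup G := Subgroup.closure {gA, gB}

/-- The generator `A` as an element of `F`. -/
def fA : F := ⟨gA, Subgroup.subset_closure (by simp)⟩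

/-- The generator `B` as an element of `F`. -/
def fB : F := ⟨gB, Subgroup.subset_closure (by simp)⟩

end SolvIso

/-!
The algebra `L = 𝔽₃[a]` is a field with `81` elements on which conjugation by `b` is the Frobenius
map, and taking first rows identifies `L` with the space of row vectors, so that `a` acts there by
multiplication by the fifth root of unity `ζ = a` and `b` by `z ↦ z ^ 27`. In these coordinates the
conjugates of `C` and `D` under `A` generate the group of all `pElt u x p`, where `u ∈ L⁴` and
`x, p ∈ L`; its order is `81 ^ 6`. Cubing sends `pElt u x p` to a central element depending only on
`u 0` and `x`, so `P` has exponent `9`.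

Nontrivial powers of `A` act on `P` without fixed points, so for `5 ∤ i` the coset `P A ^ i` is a
single conjugacy class and its elements have order `5`. Likewise every element of `P A ^ i B ^ j`
with `4 ∤ j` is conjugate into `P B ^ j`, and since `B ^ 2` acts as the involution `z ↦ z ^ 9`, the
twelfth power of such an element is trivial. Hence the element orders of `G` are the divisors of
`5`, `9` and `12`.

The characteristic polynomial of a symplectic `4 × 4` matrix is palindromic. Each of the nine
palindromic monic quartics over `𝔽₃` divides `X ^ n - 1` or `X ^ n + 1` with `n` one of `5`, `9`,
`12`, so the element orders of `PSp₄(3)` are the same divisors.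
-/

namespace SolvIso

open Subgroup

/-! ### Groups -/

section Group

variable {Γ : Type*} [Group Γ]

theorem elementOrders_eq_setOf_dvd {S : Set ℕ} (hS₀ : 0 ∉ S) (hS : S ⊆ elementOrders Γ)
    (h : ∀ g : Γ, ∃ n ∈ S, g ^ n = 1) : elementOrders Γ = {m | ∃ n ∈ S, m ∣ n} := by
  ext m
  constructor
  · rintro ⟨g, rfl⟩
    obtain ⟨n, hn, hg⟩ := h g
    exact ⟨n, hn, orderOf_dvd_of_pow_eq_one hg⟩
  · rintro ⟨_, hn, k, rfl⟩
    obtain ⟨g, hg⟩ := hS hn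
    have hk : k ≠ 0 := by rintro rfl; exact hS₀ hn
    refine ⟨g ^ k, ?_⟩
    rw [orderOf_pow_of_dvd hk (hg ▸ dvd_mul_left k m), hg,
      Nat.mul_div_cancel _ (Nat.pos_of_ne_zero hk)]

theorem maxElementOrders_eq_of_isAntichain {S : Set ℕ} (hS : IsAntichain (· ∣ ·) S)
    (h : elementOrders Γ = {m | ∃ n ∈ S, m ∣ n}) : maxElementOrders Γ = S := by
  ext m
  simp only [maxElementOrders, h, Set.mem_ofPred_eq]
  constructor
  · rintro ⟨⟨n, hn, hmn⟩, hmax⟩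
    rwa [← hmax n ⟨n, hn, dvd_rfl⟩ hmn]
  · refine fun hm => ⟨⟨m, hm, dvd_rfl⟩, fun k ⟨n, hn, hkn⟩ hmk => ?_⟩
    obtain rfl : m = n := hS.eq hm hn (hmk.trans hkn)
    exact Nat.dvd_antisymm hkn hmk

theorem isConj_mul_of_fixedPointFree {N : Subgroup Γ} [N.Normal] [Finite N] {t : Γ}
    (ht : ∀ x ∈ N, t * x = x * t → x = 1) {q : Γ} (hq : q ∈ N) : IsConj t (q * t) := by
  have hfix : MonoidHom.FixedPointFree (MulAut.conjNormal (H := N) t) := fun x hx => by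
    refine Subtype.ext (ht x x.2 ?_)
    rw [← mul_inv_eq_iff_eq_mul, ← MulAut.conjNormal_apply, hx]
  obtain ⟨p, hp⟩ := hfix.commutatorMap_surjective ⟨q, hq⟩
  rw [isConj_iff]
  refine ⟨p, ?_⟩
  have hp : (p : Γ) / (t * p * t⁻¹) = q := congrArg Subtype.val hp
  rw [← hp, div_eq_mul_inv, mul_inv_rev, mul_inv_rev]
  group

theorem isComplement'_of_coprime_of_sup_eq_top {N H : Subgroup Γ} [N.Normal]
    (hcard : (Nat.card N).Coprime (Nat.card H)) (hsup : N ⊔ H = ⊤) : N.IsComplement' H :=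
  isComplement'_of_disjoint_and_mul_eq_univ (disjoint_of_coprime_natCard hcard) <| by
    rw [← normal_mul, hsup, coe_top]

theorem isSolvable_of_isComplement' {N H : Subgroup Γ} [N.Normal] [Group.IsSolvable N]
    [Group.IsSolvable H] (h : N.IsComplement' H) : Group.IsSolvable Γ := by
  have e := h.symm.QuotientMulEquiv
  exact (Group.isSolvable_iff_subgroup_quotient N).2
    ⟨inferInstance, Group.isSolvable_of_surjective (f := e.symm.toMonoidHom) e.symm.surjective⟩

theorem le_of_isPGroup_of_coprime_index {p : ℕ} {N Q : Subgroup Γ} [Q.Normal]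
    (hQ : p.Coprime Q.index) (hN : IsPGroup p N) : N ≤ Q := by
  intro n hn
  obtain ⟨k, hk⟩ := hN ⟨n, hn⟩
  have hk : n ^ p ^ k = 1 := congrArg Subtype.val hk
  rw [← QuotientGroup.eq_one_iff, ← orderOf_eq_one_iff]
  refine Nat.eq_one_of_dvd_coprimes (hQ.pow_left k) ?_ (orderOf_dvd_natCard _)
  rw [orderOf_dvd_iff_pow_eq_one, ← QuotientGroup.mk_pow, hk, QuotientGroup.mk_one]

theorem eq_top_of_forall_generator_mem {S : Set Γ} {K : Subgroup (closure S)}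
    (h : ∀ s (hs : s ∈ S), ⟨s, subset_closure hs⟩ ∈ K) : K = ⊤ :=
  top_le_iff.1 <| (closure_closure_coe_preimage (k := S)).ge.trans <|
    (closure_le K).2 fun x hx => h x hx

theorem exists_pow_eq_of_mem_zpowers {x y : Γ} (hx : IsOfFinOrder x) (hy : y ∈ zpowers x) :
    ∃ i < orderOf x, x ^ i = y := by
  classical
  simpa using hx.mem_powers_iff_mem_range_orderOf.1 (hx.mem_powers_iff_mem_zpowers.2 hy)

end Group

open Matrix Polynomial

/-! ### The element orders of `S₄(3)` -/

section S43

theorem charpoly_reverse_of_mem_symplecticGroup {l K : Type*} [Fintype l] [DecidableEq l] [Field K]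
    {M : Matrix (l ⊕ l) (l ⊕ l) K} (hM : M ∈ symplecticGroup l K) :
    M.charpoly.reverse = M.charpoly := by
  have hdet := SymplecticGroup.det_eq_one hM
  have hu : IsUnit M := (isUnit_iff_isUnit_det M).2 (by simp only [hdet, isUnit_one])
  -- `M⁻¹` is similar to `Mᵀ`, so `M` and `M⁻¹` have the same characteristic polynomial
  have hinv := charpoly_inv M hu
  rw [SymplecticGroup.inv_eq_symplectic_inv M hM, neg_mul, neg_mul, ← mul_neg,
    charpoly_mul_comm, ← mul_assoc, neg_mul, J_squared, neg_neg, one_mul,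
    charpoly_transpose, hdet, ← reverse_charpoly] at hinv
  simpa [Fintype.card_sum, ← two_mul] using hinv.symm

theorem exists_charpoly_eq_palindromic {K : Type*} [Field K]
    {M : Matrix (Fin 2 ⊕ Fin 2) (Fin 2 ⊕ Fin 2) K} (hM : M ∈ symplecticGroup (Fin 2) K) :
    ∃ c e : K, M.charpoly = X ^ 4 + C c * X ^ 3 + C e * X ^ 2 + C c * X + 1 := by
  have hdeg : M.charpoly.natDegree = 4 := by simp [charpoly_natDegree_eq_dim]
  have hrev : ∀ i ≤ 4, M.charpoly.coeff i = M.charpoly.coeff (4 - i) := fun i hi => by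
    conv_lhs => rw [← charpoly_reverse_of_mem_symplecticGroup hM, coeff_reverse, hdeg, revAt_le hi]
  have h4 : M.charpoly.coeff 4 = 1 := hdeg ▸ (charpoly_monic M).coeff_natDegree
  have h0 : M.charpoly.coeff 0 = 1 := (hrev 0 (by norm_num)).trans h4
  refine ⟨M.charpoly.coeff 1, M.charpoly.coeff 2, ?_⟩
  have hsum := M.charpoly.as_sum_range_C_mul_X_pow
  have h3 : M.charpoly.coeff 3 = M.charpoly.coeff 1 := hrev 3 (by norm_num)
  simp only [hdeg, Finset.sum_range_succ, Finset.sum_range_zero, h3, h4, h0, map_one] at hsum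
  exact hsum.trans (by ring)

theorem exists_palindromic_dvd (c e : ZMod 3) : ∃ n ∈ ({5, 9, 12} : Set ℕ),
    X ^ 4 + C c * X ^ 3 + C e * X ^ 2 + C c * X + 1 ∣ (X ^ n - 1 : (ZMod 3)[X]) ∨
    X ^ 4 + C c * X ^ 3 + C e * X ^ 2 + C c * X + 1 ∣ (X ^ n + 1 : (ZMod 3)[X]) := by
  have h3 : (3 : (ZMod 3)[X]) = 0 := CharP.cast_eq_zero _ 3
  have cube_add : (X ^ 4 + 1 : (ZMod 3)[X]) ^ 3 = X ^ 12 + 1 := by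
    linear_combination (X ^ 4 + X ^ 8) * h3
  have cube_sub : ((X ^ 2 + 1) * (X - 1) * (X + 1) : (ZMod 3)[X]) ^ 3 = X ^ 12 - 1 := by
    linear_combination (X ^ 4 - X ^ 8) * h3
  have ninth_add : (X + 1 : (ZMod 3)[X]) ^ 9 = X ^ 9 + 1 := by
    simpa using add_pow_char_pow (p := 3) (n := 2) (X : (ZMod 3)[X]) 1
  have ninth_sub : (X - 1 : (ZMod 3)[X]) ^ 9 = X ^ 9 - 1 := by
    simpa using sub_pow_char_pow (p := 3) (n := 2) (X : (ZMod 3)[X]) 1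
  have hcase : ∀ x : ZMod 3, x = 0 ∨ x = 1 ∨ x = -1 := by decide
  rcases hcase c with rfl | rfl | rfl <;> rcases hcase e with rfl | rfl | rfl <;>
    simp only [map_zero, map_one, map_neg]
  · exact ⟨12, by simp, .inr ⟨(X ^ 4 + 1) ^ 2, by rw [← cube_add]; ring⟩⟩
  · exact ⟨12, by simp, .inl ⟨(X ^ 2 + 1) ^ 3 * (X ^ 2 - 1), by
      rw [← cube_sub]; linear_combination (-X ^ 2 * (X ^ 2 + 1) ^ 3 * (X ^ 2 - 1)) * h3⟩⟩
  · exact ⟨12, by simp, .inl ⟨(X ^ 2 + 1) * (X ^ 2 - 1) ^ 3, by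
      rw [← cube_sub]; linear_combination (X ^ 2 * (X ^ 2 + 1) * (X ^ 2 - 1) ^ 3) * h3⟩⟩
  · exact ⟨9, by simp, .inr ⟨(X + 1) ^ 5, by
      rw [← ninth_add]; linear_combination ((X ^ 3 + 2 * X ^ 2 + X) * (X + 1) ^ 5) * h3⟩⟩
  · exact ⟨5, by simp, .inl ⟨X - 1, by ring⟩⟩
  · exact ⟨12, by simp, .inl ⟨(X ^ 2 + 1) ^ 2 * (X - 1) * (X + 1) ^ 3, by
      rw [← cube_sub]
      linear_combination (-(X ^ 3 - X ^ 2 + X) * ((X ^ 2 + 1) ^ 2 * (X - 1) * (X + 1) ^ 3)) * h3⟩⟩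
  · exact ⟨9, by simp, .inl ⟨(X - 1) ^ 5, by
      rw [← ninth_sub]; linear_combination ((-X ^ 3 + 2 * X ^ 2 - X) * (X - 1) ^ 5) * h3⟩⟩
  · exact ⟨5, by simp, .inr ⟨X + 1, by ring⟩⟩
  · exact ⟨12, by simp, .inl ⟨(X ^ 2 + 1) ^ 2 * (X - 1) ^ 3 * (X + 1), by
      rw [← cube_sub]
      linear_combination ((X ^ 3 + X ^ 2 + X) * ((X ^ 2 + 1) ^ 2 * (X - 1) ^ 3 * (X + 1))) * h3⟩⟩

/-- `𝔽₃`-matrices of the size of the elements of `Sp₄(3)`. -/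
local notation "Mat" => Matrix (Fin 2 ⊕ Fin 2) (Fin 2 ⊕ Fin 2) (ZMod 3)

theorem exists_symplectic_pow_eq {M : Mat} (hM : M ∈ symplecticGroup (Fin 2) (ZMod 3)) :
    ∃ n ∈ ({5, 9, 12} : Set ℕ), M ^ n = 1 ∨ M ^ n = -1 := by
  obtain ⟨c, e, h⟩ := exists_charpoly_eq_palindromic hM
  obtain ⟨n, hn, hdvd⟩ := exists_palindromic_dvd c e
  rw [← h] at hdvd
  have cayley_hamilton := aeval_self_charpoly M
  refine ⟨n, hn, hdvd.imp (fun hd => ?_) fun hd => ?_⟩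
  · simpa [sub_eq_zero] using aeval_eq_zero_of_dvd_aeval_eq_zero hd cayley_hamilton
  · simpa [add_eq_zero_iff_eq_neg] using aeval_eq_zero_of_dvd_aeval_eq_zero hd cayley_hamilton

theorem mem_center_symplecticGroup {l R : Type*} [Fintype l] [DecidableEq l] [CommRing R]
    {M : symplecticGroup l R} (h : (M : Matrix (l ⊕ l) (l ⊕ l) R) = 1 ∨
      (M : Matrix (l ⊕ l) (l ⊕ l) R) = -1) : M ∈ center (symplecticGroup l R) := by
  rw [mem_center_iff]
  intro N
  apply Subtype.ext
  rcases h with h | h <;> simp [h]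

theorem S43_mk_pow_eq_one_iff {M : symplecticGroup (Fin 2) (ZMod 3)} {n : ℕ} :
    (QuotientGroup.mk M : S43) ^ n = 1 ↔ M ^ n ∈ center (symplecticGroup (Fin 2) (ZMod 3)) := by
  rw [← QuotientGroup.mk_pow, QuotientGroup.eq_one_iff]

theorem S43_mk_pow_eq_one {M : symplecticGroup (Fin 2) (ZMod 3)} {n : ℕ}
    (h : (M : Mat) ^ n = 1 ∨ (M : Mat) ^ n = -1) : (QuotientGroup.mk M : S43) ^ n = 1 :=
  S43_mk_pow_eq_one_iff.2 (mem_center_symplecticGroup (by rwa [SubmonoidClass.coe_pow]))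

theorem S43_mem_elementOrders {M : Mat} (hM : M ∈ symplecticGroup (Fin 2) (ZMod 3)) {n : ℕ}
    (hn : 0 < n) (h : M ^ n = 1 ∨ M ^ n = -1)
    (h' : ∀ p ∈ n.primeFactors, ∃ N ∈ symplecticGroup (Fin 2) (ZMod 3),
      N * M ^ (n / p) ≠ M ^ (n / p) * N) : n ∈ elementOrders S43 := by
  refine ⟨QuotientGroup.mk ⟨M, hM⟩, orderOf_eq_of_pow_and_pow_div_prime hn
    (S43_mk_pow_eq_one h) fun p hp hpn h1 => ?_⟩
  obtain ⟨N, hN, hne⟩ := h' p (Nat.mem_primeFactors.2 ⟨hp, hpn, hn.ne'⟩)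
  exact hne (congrArg Subtype.val (mem_center_iff.1 (S43_mk_pow_eq_one_iff.1 h1) ⟨N, hN⟩))

theorem subset_elementOrders_S43 : {5, 9, 12} ⊆ elementOrders S43 := by
  have h5 : (fromBlocks 0 (-1) 1 !![1, 2; 2, 0] : Mat) ∈ symplecticGroup (Fin 2) (ZMod 3) := by
    rw [SymplecticGroup.mem_iff]; decide +kernel
  have h9 : (fromBlocks !![2, 0; 2, 0] !![0, 1; 0, 0] !![0, 2; 0, 1] !![0, 0; 2, 0] : Mat) ∈
      symplecticGroup (Fin 2) (ZMod 3) := by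
    rw [SymplecticGroup.mem_iff]; decide +kernel
  have h12 : (fromBlocks 0 1 (-1) !![2, 0; 0, 0] : Mat) ∈ symplecticGroup (Fin 2) (ZMod 3) := by
    rw [SymplecticGroup.mem_iff]; decide +kernel
  rintro n (rfl | rfl | rfl)
  · refine S43_mem_elementOrders h5 (by norm_num) (.inr (by decide +kernel)) fun p hp => ?_
    rw [show Nat.primeFactors 5 = {5} by decide +kernel, Finset.mem_singleton] at hp
    exact ⟨_, h9, by subst hp; decide +kernel⟩
  · refine S43_mem_elementOrders h9 (by norm_num) (.inr (by decide +kernel)) fun p hp => ?_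
    rw [show Nat.primeFactors 9 = {3} by decide +kernel, Finset.mem_singleton] at hp
    exact ⟨_, h5, by subst hp; decide +kernel⟩
  · refine S43_mem_elementOrders h12 (by norm_num) (.inl (by decide +kernel)) fun p hp => ?_
    rw [show Nat.primeFactors 12 = {2, 3} by decide +kernel, Finset.mem_insert,
      Finset.mem_singleton] at hp
    exact ⟨_, h9, by rcases hp with rfl | rfl <;> decide +kernel⟩

theorem elementOrders_S43 : elementOrders S43 = {m | ∃ n ∈ ({5, 9, 12} : Set ℕ), m ∣ n} := by
  refine elementOrders_eq_setOf_dvd (by simp) subset_elementOrders_S43 fun g => ?_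
  obtain ⟨M, rfl⟩ := QuotientGroup.mk_surjective g
  obtain ⟨n, hn, h⟩ := exists_symplectic_pow_eq M.2
  exact ⟨n, hn, S43_mk_pow_eq_one h⟩

end S43

/-! ### The field `𝔽₃[a]` -/

/-- The algebra `𝔽₃[a]`; it is a field with `81` elements, and conjugation by `b` induces its
Frobenius automorphism. -/
abbrev L : Subalgebra (ZMod 3) M4 := Algebra.adjoin (ZMod 3) {a}

instance : CharP L 3 := charP_of_injective_algebraMap' (ZMod 3) 3

/-- The fifth root of unity `a` of the field `𝔽₃[a]`. -/
def ζ : L := ⟨a, Algebra.self_mem_adjoin_singleton (ZMod 3) a⟩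

theorem ζ_pow_five : ζ ^ 5 = 1 := Subtype.ext a_pow

theorem b_mul (x : L) : b * x = x ^ 3 • b := by
  obtain ⟨x, hx⟩ := x
  change b * x = x ^ 3 * b
  induction hx using Algebra.adjoin_induction with
  | mem x hx =>
    obtain rfl : x = a := hx
    decide +kernel
  | algebraMap r =>
    rw [← map_pow, ZMod.pow_card]
    exact (Algebra.commutes r b).symm
  | add x y hx hy ihx ihy =>
    have frobenius_add : (x + y) ^ 3 = x ^ 3 + y ^ 3 :=
      congrArg Subtype.val (add_pow_char (⟨x, hx⟩ : L) ⟨y, hy⟩ 3)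
    rw [mul_add, ihx, ihy, frobenius_add, add_mul]
  | mul x y hx hy ihx ihy =>
    have frobenius_mul : (x * y) ^ 3 = x ^ 3 * y ^ 3 :=
      congrArg Subtype.val (mul_pow (⟨x, hx⟩ : L) ⟨y, hy⟩ 3)
    rw [← mul_assoc, ihx, mul_assoc, ihy, frobenius_mul, mul_assoc]

theorem b_pow_mul (i : ℕ) (x : L) : b ^ i * x = x ^ 3 ^ i • b ^ i := by
  induction i generalizing x with
  | zero => simp [Subalgebra.smul_def]
  | succ i ih =>
    calc b ^ (i + 1) * x = b ^ i * ↑(x ^ 3) * b := by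
          rw [pow_succ, mul_assoc, b_mul, mul_assoc]; rfl
      _ = x ^ 3 ^ (i + 1) • b ^ (i + 1) := by
          rw [ih, smul_mul_assoc, ← pow_succ, ← pow_mul, ← pow_succ']

theorem smul_b_pow_mul_smul_b_pow (x y : L) (i j : ℕ) :
    (x • b ^ i) * (y • b ^ j) = (x * y ^ 3 ^ i) • b ^ (i + j) := by
  have hy : b ^ i * y • b ^ j = y ^ 3 ^ i • b ^ (i + j) := by
    rw [pow_add, ← smul_mul_assoc, ← b_pow_mul, mul_assoc]; rfl
  rw [smul_mul_assoc, hy, mul_smul]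

theorem L.pow_card (x : L) : x ^ 81 = x := by
  have h := b_pow_mul 4 x
  rw [b_pow, one_mul] at h
  exact Subtype.ext (h.trans (mul_one _)).symm

theorem L.pow_add_mul_eighty (x : L) {n : ℕ} (hn : n ≠ 0) (k : ℕ) :
    x ^ (n + 80 * k) = x ^ n := by
  obtain ⟨m, rfl⟩ := Nat.exists_eq_succ_of_ne_zero hn
  induction k with
  | zero => rfl
  | succ k ih =>
    rw [← ih, mul_add, mul_one, Nat.succ_eq_add_one,
      show m + 1 + (80 * k + 80) = m + 80 * k + 81 by ring, pow_add, L.pow_card, ← pow_succ]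
    ring

theorem L.add_pow_three (x y : L) : (x + y) ^ 3 = x ^ 3 + y ^ 3 := add_pow_char x y 3

theorem L.add_pow_nine (x y : L) : (x + y) ^ 9 = x ^ 9 + y ^ 9 := by
  simpa using add_pow_char_pow (p := 3) (n := 2) x y

theorem L.add_pow_twentySeven (x y : L) : (x + y) ^ 27 = x ^ 27 + y ^ 27 := by
  simpa using add_pow_char_pow (p := 3) (n := 3) x y

theorem isUnit_ζ_pow_sub_one {i : ℕ} (hi : ¬5 ∣ i) : IsUnit (ζ ^ i - 1) := by
  have hζ : IsUnit (ζ - 1) :=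
    .of_mul_eq_one (ζ ^ 3 + 2 * ζ ^ 2 + 1) (Subtype.ext (by decide +kernel))
  obtain ⟨j, hj⟩ := Nat.exists_mul_mod_eq_one_of_coprime
    ((Nat.Prime.coprime_iff_not_dvd Nat.prime_five).2 hi).symm (by norm_num)
  have hdvd : ζ ^ i - 1 ∣ (ζ ^ i) ^ j - 1 := by
    simpa only [one_pow] using sub_dvd_pow_sub_pow (ζ ^ i) 1 j
  rw [← pow_mul, pow_eq_pow_mod (i * j) ζ_pow_five, hj.2, pow_one] at hdvd
  exact isUnit_of_dvd_unit hdvd hζ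

theorem isUnit_ζ : IsUnit ζ := .of_pow_eq_one ζ_pow_five (by norm_num)

theorem addSubgroup_eq_top {S : AddSubgroup L} (hζ : ∀ x ∈ S, ζ * x ∈ S) {x : L} (hx : IsUnit x)
    (hxS : x ∈ S) : S = ⊤ := by
  have hmul : ∀ y : L, ∀ z ∈ S, y * z ∈ S := by
    rintro ⟨y, hy⟩
    induction hy using Algebra.adjoin_induction with
    | mem y hy =>
      obtain rfl : y = a := hy
      exact hζ
    | algebraMap r =>
      intro z hz
      change algebraMap (ZMod 3) L r * z ∈ S
      rw [← Algebra.smul_def, ← ZMod.natCast_zmod_val r, Nat.cast_smul_eq_nsmul]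
      exact nsmul_mem hz _
    | add x y hxL hyL hx hy =>
      intro z hz
      change (⟨x, hxL⟩ + ⟨y, hyL⟩ : L) * z ∈ S
      rw [add_mul]
      exact add_mem (hx z hz) (hy z hz)
    | mul x y hxL hyL hx hy =>
      intro z hz
      change (⟨x, hxL⟩ * ⟨y, hyL⟩ : L) * z ∈ S
      rw [mul_assoc]
      exact hx _ (hy z hz)
  obtain ⟨y, hyx⟩ := hx.exists_left_inv
  refine eq_top_iff.2 fun z _ => ?_
  simpa only [mul_assoc, hyx, mul_one] using hmul (z * y) x hxS

theorem d_vecMul_sum (v : Fin 4 → ZMod 3) : d ᵥ* (∑ i : Fin 4, v i • a ^ (i : ℕ)) = v := by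
  have h : ∀ i j : Fin 4, (d ᵥ* a ^ (i : ℕ)) j = if i = j then 1 else 0 := by decide +kernel
  ext j
  simp [vecMul_sum, vecMul_smul, h]

theorem firstRow_bijective : Function.Bijective fun x : L => d ᵥ* (x : M4) := by
  have surj : ∀ v, ∃ x : L, d ᵥ* (x : M4) = v := fun v =>
    ⟨∑ i, v i • ζ ^ (i : ℕ), by simpa [ζ] using d_vecMul_sum v⟩
  refine ⟨fun x y hxy => Subtype.ext (ext_of_single_vecMul fun i => ?_), surj⟩
  obtain ⟨z, hz⟩ := surj (Pi.single i 1)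
  have comm : ∀ w : L, (z : M4) * w = w * z := fun w => congrArg Subtype.val (mul_comm z w)
  rw [← hz, vecMul_vecMul, vecMul_vecMul, comm, comm, ← vecMul_vecMul, ← vecMul_vecMul]
  exact congrArg (· ᵥ* (z : M4)) hxy

/-- The elements of `𝔽₃[a]` correspond to their first rows; this identifies the space of row
vectors with the field, `d` with `1`, and the action of `a` with multiplication by `ζ`. -/
noncomputable def firstRow : L ≃+ (Fin 4 → ZMod 3) :=
  { Equiv.ofBijective _ firstRow_bijective with
    map_add' := fun x y => vecMul_add (x : M4) y d }

theorem firstRow_apply (x : L) : firstRow x = d ᵥ* (x : M4) := rfl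

theorem firstRow_vecMul (u x : L) : firstRow u ᵥ* (x : M4) = firstRow (u * x) :=
  vecMul_vecMul d (u : M4) (x : M4)

theorem firstRow_vecMul_smul_b_pow (u x : L) {i j : ℕ} (hij : i + j = 4) :
    firstRow u ᵥ* (x • b ^ i) = firstRow ((u * x) ^ 3 ^ j) := by
  have hd : ∀ k, d ᵥ* b ^ k = d := fun k => by
    induction k with
    | zero => exact vecMul_one d
    | succ k ih => rw [pow_succ, ← vecMul_vecMul, ih]; decide +kernel
  have hb : (u : M4) * x • b ^ i = b ^ i * ↑((u * x) ^ 3 ^ j) := by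
    rw [b_pow_mul, ← pow_mul, ← pow_add, add_comm j, hij, show 3 ^ 4 = 81 by rfl, L.pow_card]
    exact (mul_assoc (u : M4) x _).symm
  rw [firstRow_apply, vecMul_vecMul, hb, ← vecMul_vecMul, hd, firstRow_apply]

/-! ### Block matrices -/

theorem blockMat_mul (r s : Fin 4 → Fin 4 → ZMod 3) (X Y : Matrix (Fin 4) (Fin 4) M4) :
    blockMat r X * blockMat s Y = blockMat (fun j => s j + ∑ i, r i ᵥ* Y i j) (X * Y) := by
  rw [blockMat, blockMat, blockMat, fromBlocks_multiply, fromBlocks_inj, map_mul]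
  refine ⟨by simp, ?_, by simp, by simp⟩
  rw [Matrix.one_mul]
  ext i p
  simp [Matrix.mul_apply, Fintype.sum_prod_type, vecMul, dotProduct]

theorem blockMat_inj {r s : Fin 4 → Fin 4 → ZMod 3} {X Y : Matrix (Fin 4) (Fin 4) M4} :
    blockMat r X = blockMat s Y ↔ r = s ∧ X = Y := by
  simp only [blockMat, fromBlocks_inj, EmbeddingLike.apply_eq_iff_eq, true_and]
  refine and_congr_left fun _ => ⟨fun h => ?_, fun h => h ▸ rfl⟩
  ext i j
  exact congrFun (congrFun h 0) (i, j)

theorem blockMat_mul_blockMat_diagonal (r : Fin 4 → Fin 4 → ZMod 3)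
    (X : Matrix (Fin 4) (Fin 4) M4) (m : M4) :
    blockMat r X * blockMat 0 (diagonal fun _ => m) =
      blockMat (fun j => r j ᵥ* m) (X * diagonal fun _ => m) := by
  rw [blockMat_mul, blockMat_inj]
  refine ⟨funext fun j => ?_, rfl⟩
  rw [Finset.sum_eq_single j (fun i _ hij => by rw [diagonal_apply_ne _ hij, vecMul_zero])
    (fun h => absurd (Finset.mem_univ j) h), diagonal_apply_eq, Pi.zero_apply, zero_add]

theorem blockMat_zero_mul_blockMat (r : Fin 4 → Fin 4 → ZMod 3)
    (X Y : Matrix (Fin 4) (Fin 4) M4) : blockMat 0 X * blockMat r Y = blockMat r (X * Y) := by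
  rw [blockMat_mul, blockMat_inj]
  exact ⟨by simp, rfl⟩

/-- The unitriangular `4 × 4` matrices with the shape of the lower right part of `C`. -/
def U {R : Type*} [Ring R] (x y z s t : R) : Matrix (Fin 4) (Fin 4) R :=
  !![1, x, y, z;
     0, 1, 0, s;
     0, 0, 1, t;
     0, 0, 0, 1]

section U

variable {R : Type*} [Ring R]

theorem U_mul_U (x y z s t x' y' z' s' t' : R) :
    U x y z s t * U x' y' z' s' t' =
      U (x + x') (y + y') (z + z' + (x * s' + y * t')) (s + s') (t + t') := by
  ext1 i j
  fin_cases i <;> fin_cases j <;> simp [U, Matrix.mul_apply, Fin.sum_univ_four, add_comm]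
  abel

theorem U_zero : U (0 : R) 0 0 0 0 = 1 := by
  ext1 i j
  fin_cases i <;> fin_cases j <;> simp [U]

theorem U_inj {x y z s t x' y' z' s' t' : R} :
    U x y z s t = U x' y' z' s' t' ↔ x = x' ∧ y = y' ∧ z = z' ∧ s = s' ∧ t = t' := by
  refine ⟨fun h => ?_, by rintro ⟨rfl, rfl, rfl, rfl, rfl⟩; rfl⟩
  have entry := fun i j => congrFun (congrFun h i) j
  exact ⟨entry 0 1, entry 0 2, entry 0 3, entry 1 3, entry 2 3⟩

theorem U_mul_diagonal {x y z s t x' y' z' s' t' m : R} (hx : x * m = m * x')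
    (hy : y * m = m * y') (hz : z * m = m * z') (hs : s * m = m * s') (ht : t * m = m * t') :
    U x y z s t * diagonal (fun _ => m) = diagonal (fun _ => m) * U x' y' z' s' t' := by
  ext1 i j
  rw [mul_diagonal, diagonal_mul]
  fin_cases i <;> fin_cases j <;> simp [U, hx, hy, hz, hs, ht]

end U

theorem sum_vecMul_U (r : Fin 4 → Fin 4 → ZMod 3) (x y z s t : M4) :
    (fun j => ∑ i, r i ᵥ* U x y z s t i j) =
      ![r 0, r 0 ᵥ* x + r 1, r 0 ᵥ* y + r 2, r 0 ᵥ* z + r 1 ᵥ* s + r 2 ᵥ* t + r 3] := by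
  ext1 j
  rw [Fin.sum_univ_four]
  fin_cases j <;> simp [U]

/-- The lower right parts of the elements of `P`. They form a group of order `81 ^ 2`, which `C`
and its conjugates under `A` generate. -/
noncomputable def T (x p : L) : Matrix (Fin 4) (Fin 4) M4 :=
  U (x • b ^ 1) (x ^ 9 • b ^ 2) (p • b ^ 3 + (p ^ 27 + x ^ 36 - x) • b ^ 1)
    (-(x ^ 9 • b ^ 2)) (x ^ 3 • b ^ 3)

theorem T_zero : T 0 0 = 1 := by
  simp [T, U_zero]

theorem matC_eq : matC = blockMat 0 (T 1 0) := by
  simp [matC, T, U, c1, c2, c3, c4]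

theorem T_mul_T (x p y q : L) : T x p * T y q = T (x + y) (p + q - x * y ^ 27) := by
  have hb : b ^ (2 + 3) = b ^ 1 := by rw [show 2 + 3 = 4 + 1 by rfl, pow_add, b_pow, one_mul]
  have hz : (p + q - x * y ^ 27) ^ 27 + (x + y) ^ 36 - (x + y) =
      (p ^ 27 + x ^ 36 - x) + (q ^ 27 + y ^ 36 - y) + x ^ 9 * y ^ 27 := by
    have hp : (p + q - x * y ^ 27) ^ 27 = p ^ 27 + q ^ 27 - x ^ 27 * y ^ 9 := by
      have hy : y ^ 729 = y ^ 9 := L.pow_add_mul_eighty y (by norm_num) 9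
      rw [sub_eq_add_neg, L.add_pow_twentySeven, L.add_pow_twentySeven]
      linear_combination -x ^ 27 * hy
    have hx : (x + y) ^ 36 = (x ^ 9 + y ^ 9) * (x ^ 27 + y ^ 27) := by
      rw [← L.add_pow_nine, ← L.add_pow_twentySeven, ← pow_add]
    rw [hp, hx]
    ring
  simp only [T, U_mul_U, mul_neg, smul_b_pow_mul_smul_b_pow, hb, hz, L.add_pow_nine,
    L.add_pow_three]
  refine U_inj.2 ⟨?_, ?_, ?_, ?_, ?_⟩
  · module
  · module
  · module
  · module
  · module

theorem smul_b_pow_mul_a (z w : L) {i : ℕ} (h : z * ζ ^ 3 ^ i = ζ * w) :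
    z • b ^ i * a = a * w • b ^ i := by
  have ha : a = ζ • b ^ 0 := (mul_one a).symm
  rw [ha, smul_b_pow_mul_smul_b_pow, smul_b_pow_mul_smul_b_pow, pow_zero 3, pow_one, h, add_comm]

theorem smul_b_pow_mul_b (z : L) (i : ℕ) : z • b ^ i * b = b * z ^ 27 • b ^ i := by
  have hb : b = (1 : L) • b ^ 1 := by rw [one_smul, pow_one]
  nth_rewrite 2 3 [hb]
  rw [smul_b_pow_mul_smul_b_pow, smul_b_pow_mul_smul_b_pow, one_pow, mul_one, one_mul, ← pow_mul,
    show 27 * 3 ^ 1 = 81 by rfl, L.pow_card, add_comm]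

theorem T_mul_diagonal_a (x p : L) :
    T x p * diagonal (fun _ => a) = diagonal (fun _ => a) * T (ζ ^ 2 * x) (ζ * p) := by
  have hζ : ∀ n, ζ ^ n = ζ ^ (n % 5) := fun n => pow_eq_pow_mod n ζ_pow_five
  have hy : x ^ 9 • b ^ 2 * a = a * (ζ ^ 2 * x) ^ 9 • b ^ 2 :=
    smul_b_pow_mul_a _ _ (by linear_combination x ^ 9 * (hζ 9 - hζ 19))
  refine U_mul_diagonal (smul_b_pow_mul_a _ _ ?_) hy ?_ ?_ (smul_b_pow_mul_a _ _ ?_)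
  · ring
  · rw [add_mul, mul_add]
    refine congrArg₂ (· + ·) (smul_b_pow_mul_a _ _ ?_) (smul_b_pow_mul_a _ _ ?_)
    · linear_combination p * hζ 27
    · linear_combination -p ^ 27 * hζ 28 - x ^ 36 * hζ 73
  · rw [neg_mul, mul_neg, hy]
  · linear_combination x ^ 3 * hζ 27 - x ^ 3 * hζ 7

theorem T_mul_diagonal_b (x p : L) :
    T x p * diagonal (fun _ => b) = diagonal (fun _ => b) * T (x ^ 27) (p ^ 27) := by
  have hz : (p ^ 27 + x ^ 36 - x) ^ 27 = (p ^ 27) ^ 27 + (x ^ 27) ^ 36 - x ^ 27 := by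
    rw [sub_eq_add_neg, L.add_pow_twentySeven, L.add_pow_twentySeven]
    ring
  refine U_mul_diagonal ?_ ?_ ?_ ?_ ?_ <;>
    simp only [add_mul, mul_add, neg_mul, mul_neg, smul_b_pow_mul_b, hz, ← pow_mul,
      Nat.reduceMul]

theorem isUnit_b : IsUnit b := .of_pow_eq_one b_pow (by norm_num)

theorem eq_of_smul_b_cube_add_smul_b_eq {p p' q q' : L}
    (h : p • b ^ 3 + p' • b ^ 1 = q • b ^ 3 + q' • b ^ 1) : p = q := by
  have hb : (p - q) • b ^ 2 = (q' - p') • (1 : M4) := by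
    have hb1 : b ^ 1 * b ^ 3 = 1 := by rw [← pow_add, b_pow]
    have hb3 : b ^ 3 * b ^ 3 = b ^ 2 := by
      rw [← pow_add, show 3 + 3 = 4 + 2 by rfl, pow_add, b_pow, one_mul]
    have h' := congrArg (fun m => m * b ^ 3) h
    simp only [add_mul, smul_mul_assoc, hb1, hb3] at h'
    linear_combination (norm := module) h'
  have hcomm : (ζ ^ 9 * (p - q)) • b ^ 2 = (ζ * (p - q)) • b ^ 2 := by
    have hζ : b ^ 2 * ζ = ζ ^ 9 • b ^ 2 := b_pow_mul 2 ζ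
    have hL : (q' - p') • (1 : M4) * ζ = ζ • ((q' - p') • (1 : M4)) := by
      rw [smul_mul_assoc, one_mul, smul_smul, mul_comm, mul_smul]
      exact congrArg ((q' - p') • ·) (mul_one (ζ : M4)).symm
    rw [mul_smul ζ, hb, ← hL, ← hb, smul_mul_assoc, hζ, smul_smul, mul_comm]
  have hpq : ζ * (ζ ^ 8 - 1) * (p - q) = 0 := by
    have h : ζ ^ 9 * (p - q) = ζ * (p - q) :=
      Subtype.ext ((isUnit_b.pow 2).mul_left_inj.1 hcomm)
    linear_combination h
  exact sub_eq_zero.1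
    (((isUnit_ζ.mul (isUnit_ζ_pow_sub_one (by norm_num))).mul_right_eq_zero).1 hpq)

theorem T_inj {x p y q : L} : T x p = T y q ↔ x = y ∧ p = q := by
  refine ⟨fun h => ?_, fun ⟨hx, hp⟩ => by rw [hx, hp]⟩
  obtain ⟨hx, -, hp, -⟩ := U_inj.1 h
  exact ⟨Subtype.ext ((isUnit_b.pow 1).mul_left_inj.1 hx), eq_of_smul_b_cube_add_smul_b_eq hp⟩

/-- The elements of `P`, parametrized by `𝔽₃[a]`: the four row vectors by `u` and the lower right
part by `x` and `p`. -/
noncomputable def pMat (u : Fin 4 → L) (x p : L) : Matrix Idx Idx (ZMod 3) :=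
  blockMat (fun j => firstRow (u j)) (T x p)

/-- The action of `T y q` on quadruples of row vectors, in the coordinates of `pMat`. -/
noncomputable def rowAct (u : Fin 4 → L) (y q : L) : Fin 4 → L :=
  ![u 0, u 0 ^ 27 * y ^ 27 + u 1, u 0 ^ 9 * y + u 2,
    u 0 ^ 3 * q ^ 3 + u 0 ^ 27 * (q ^ 9 + y ^ 12 - y ^ 27) - u 1 ^ 9 * y + u 2 ^ 3 * y ^ 9 + u 3]

theorem vecMul_T (u : Fin 4 → L) (y q : L) :
    (fun j => ∑ i, firstRow (u i) ᵥ* T y q i j) = fun j => firstRow (rowAct u y q j) := by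
  have hz : (u 0 * (q ^ 27 + y ^ 36 - y)) ^ 27 = u 0 ^ 27 * (q ^ 9 + y ^ 12 - y ^ 27) := by
    have hq : q ^ 729 = q ^ 9 := L.pow_add_mul_eighty q (by norm_num) 9
    have hy : y ^ 972 = y ^ 12 := L.pow_add_mul_eighty y (by norm_num) 12
    rw [mul_pow, sub_eq_add_neg, L.add_pow_twentySeven, L.add_pow_twentySeven]
    linear_combination u 0 ^ 27 * (hq + hy)
  have b₁ := fun z w : L => firstRow_vecMul_smul_b_pow z w (show 1 + 3 = 4 by rfl)
  have b₂ := fun z w : L => firstRow_vecMul_smul_b_pow z w (show 2 + 2 = 4 by rfl)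
  have b₃ := fun z w : L => firstRow_vecMul_smul_b_pow z w (show 3 + 1 = 4 by rfl)
  have h81 : ∀ z : L, (z ^ 9) ^ 9 = z := fun z => by rw [← pow_mul, L.pow_card]
  rw [T, sum_vecMul_U]
  simp only [vecMul_add, vecMul_neg, b₁, b₂, b₃, Nat.reducePow, hz, mul_pow, h81]
  ext1 j
  fin_cases j <;> simp [rowAct, ← map_add, ← map_neg]
  ring

theorem pMat_zero : pMat 0 0 0 = 1 := by
  rw [pMat, T_zero, ← blockMat_zero_one, blockMat_inj]
  exact ⟨funext fun _ => map_zero firstRow, rfl⟩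

theorem pMat_inj {u v : Fin 4 → L} {x p y q : L} :
    pMat u x p = pMat v y q ↔ u = v ∧ x = y ∧ p = q := by
  rw [pMat, pMat, blockMat_inj, T_inj, funext_iff, funext_iff]
  simp only [EmbeddingLike.apply_eq_iff_eq]

theorem pMat_mul_pMat (u v : Fin 4 → L) (x p y q : L) :
    pMat u x p * pMat v y q = pMat (v + rowAct u y q) (x + y) (p + q - x * y ^ 27) := by
  rw [pMat, pMat, blockMat_mul, T_mul_T, pMat, blockMat_inj]
  refine ⟨funext fun j => ?_, rfl⟩
  rw [congrFun (vecMul_T u y q) j, Pi.add_apply, map_add]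

theorem rowAct_rowAct (u : Fin 4 → L) (x p : L) :
    u + rowAct (u + rowAct u x p) x p =
      Pi.single 3 (u 0 ^ 27 * x ^ 12 - u 0 ^ 3 * x ^ 4) := by
  have h3 : (3 : L) = 0 := CharP.cast_eq_zero L 3
  have h243 : ∀ z : L, z ^ 243 = z ^ 3 := fun z => L.pow_add_mul_eighty z (by norm_num) 3
  ext1 j
  fin_cases j <;>
    simp [rowAct, L.add_pow_three, L.add_pow_nine, L.add_pow_twentySeven, mul_pow, ← pow_mul, h243]
  · linear_combination u 0 * h3
  · linear_combination (u 1 + u 0 ^ 27 * x ^ 27) * h3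
  · linear_combination (u 2 + u 0 ^ 9 * x) * h3
  · linear_combination (u 3 + u 0 ^ 3 * p ^ 3 + u 0 ^ 27 * (p ^ 9 + x ^ 12 - x ^ 27) -
      u 1 ^ 9 * x + u 2 ^ 3 * x ^ 9) * h3

theorem pMat_pow_three (u : Fin 4 → L) (x p : L) :
    pMat u x p ^ 3 = pMat (Pi.single 3 (u 0 ^ 27 * x ^ 12 - u 0 ^ 3 * x ^ 4)) 0 0 := by
  have h3 : (3 : L) = 0 := CharP.cast_eq_zero L 3
  rw [pow_succ, pow_two, pMat_mul_pMat, pMat_mul_pMat, rowAct_rowAct, pMat_inj]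
  refine ⟨rfl, ?_, ?_⟩
  · linear_combination x * h3
  · linear_combination (p - x ^ 28) * h3

theorem pMat_pow_nine (u : Fin 4 → L) (x p : L) : pMat u x p ^ 9 = 1 := by
  rw [show 9 = 3 * 3 by rfl, pow_mul, pMat_pow_three, pMat_pow_three, ← pMat_zero]
  simp

theorem pMat_mul_matA (u : Fin 4 → L) (x p : L) :
    pMat u x p * matA = matA * pMat (ζ • u) (ζ ^ 2 * x) (ζ * p) := by
  rw [matA, pMat, blockMat_mul_blockMat_diagonal, pMat, blockMat_zero_mul_blockMat,
    T_mul_diagonal_a]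
  simp only [Pi.smul_apply, smul_eq_mul, mul_comm ζ (u _), ← firstRow_vecMul]
  rfl

theorem pMat_mul_matB (u : Fin 4 → L) (x p : L) :
    pMat u x p * matB = matB * pMat (u ^ 27) (x ^ 27) (p ^ 27) := by
  have hb : ∀ z : L, firstRow z ᵥ* b = firstRow (z ^ 27) := fun z => by
    simpa using firstRow_vecMul_smul_b_pow z 1 (show 1 + 3 = 4 by rfl)
  rw [matB, pMat, blockMat_mul_blockMat_diagonal, pMat, blockMat_zero_mul_blockMat,
    T_mul_diagonal_b]
  simp only [hb, Pi.pow_apply]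

/-! ### The group `P` in coordinates -/

/-- The matrix `pMat u x p` as an element of `GL₁₇(𝔽₃)`. -/
noncomputable def pElt (u : Fin 4 → L) (x p : L) : GL Idx (ZMod 3) :=
  Units.ofPowEqOne (pMat u x p) 9 (pMat_pow_nine u x p) (by norm_num)

theorem pElt_zero : pElt 0 0 0 = 1 := Units.ext pMat_zero

theorem pElt_inj {u v : Fin 4 → L} {x p y q : L} :
    pElt u x p = pElt v y q ↔ u = v ∧ x = y ∧ p = q := by
  rw [← pMat_inj]
  exact Units.ext_iff

theorem pElt_mul_pElt (u v : Fin 4 → L) (x p y q : L) :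
    pElt u x p * pElt v y q = pElt (v + rowAct u y q) (x + y) (p + q - x * y ^ 27) :=
  Units.ext (pMat_mul_pMat u v x p y q)

theorem pElt_inv (u : Fin 4 → L) (x p : L) :
    (pElt u x p)⁻¹ = pElt (-rowAct u (-x) (-p - x ^ 28)) (-x) (-p - x ^ 28) := by
  rw [inv_eq_iff_mul_eq_one, pElt_mul_pElt, ← pElt_zero, pElt_inj]
  exact ⟨neg_add_cancel _, add_neg_cancel x, by ring⟩

theorem pElt_pow_three (u : Fin 4 → L) (x p : L) :
    pElt u x p ^ 3 = pElt (Pi.single 3 (u 0 ^ 27 * x ^ 12 - u 0 ^ 3 * x ^ 4)) 0 0 :=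
  Units.ext (pMat_pow_three u x p)

theorem pElt_pow_nine (u : Fin 4 → L) (x p : L) : pElt u x p ^ 9 = 1 :=
  Units.ext (pMat_pow_nine u x p)

theorem pElt_mul_uA (u : Fin 4 → L) (x p : L) :
    pElt u x p * uA = uA * pElt (ζ • u) (ζ ^ 2 * x) (ζ * p) :=
  Units.ext (pMat_mul_matA u x p)

theorem pElt_mul_uB (u : Fin 4 → L) (x p : L) :
    pElt u x p * uB = uB * pElt (u ^ 27) (x ^ 27) (p ^ 27) :=
  Units.ext (pMat_mul_matB u x p)

theorem uC_eq : uC = pElt 0 1 0 := by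
  refine Units.ext (matC_eq.trans ?_)
  exact blockMat_inj.2 ⟨funext fun _ => (map_zero firstRow).symm, rfl⟩

theorem uD_eq : uD = pElt (Pi.single 0 1) 0 0 := by
  have h : matD = pMat (Pi.single 0 1) 0 0 := by
    rw [matD, pMat, T_zero, blockMat_inj]
    refine ⟨funext fun j => ?_, rfl⟩
    fin_cases j <;> simp [firstRow_apply]
  exact Units.ext h

/-- The group of all `pElt u x p`; it is the image of `P` in `GL₁₇(𝔽₃)`. -/
noncomputable def pGroup : Subgroup (GL Idx (ZMod 3)) where
  carrier := Set.range fun t : (Fin 4 → L) × L × L => pElt t.1 t.2.1 t.2.2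
  one_mem' := ⟨(0, 0, 0), pElt_zero⟩
  mul_mem' := by
    rintro _ _ ⟨⟨u, x, p⟩, rfl⟩ ⟨⟨v, y, q⟩, rfl⟩
    exact ⟨(_, _, _), (pElt_mul_pElt u v x p y q).symm⟩
  inv_mem' := by
    rintro _ ⟨⟨u, x, p⟩, rfl⟩
    exact ⟨(_, _, _), (pElt_inv u x p).symm⟩

theorem mem_pGroup {g : GL Idx (ZMod 3)} : g ∈ pGroup ↔ ∃ u x p, pElt u x p = g :=
  ⟨fun ⟨⟨u, x, p⟩, h⟩ => ⟨u, x, p, h⟩, fun ⟨u, x, p, h⟩ => ⟨(u, x, p), h⟩⟩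

theorem pElt_mem_pGroup (u : Fin 4 → L) (x p : L) : pElt u x p ∈ pGroup :=
  mem_pGroup.2 ⟨u, x, p, rfl⟩

theorem uC_mem_pGroup : uC ∈ pGroup := uC_eq ▸ pElt_mem_pGroup 0 1 0

theorem uD_mem_pGroup : uD ∈ pGroup := uD_eq ▸ pElt_mem_pGroup (Pi.single 0 1) 0 0

theorem card_pGroup : Nat.card pGroup = 3 ^ 24 := by
  have hinj : Function.Injective fun t : (Fin 4 → L) × L × L => pElt t.1 t.2.1 t.2.2 := by
    rintro ⟨u, x, p⟩ ⟨v, y, q⟩ h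
    obtain ⟨rfl, rfl, rfl⟩ := pElt_inj.1 h
    rfl
  have hL : Nat.card L = 81 := by
    rw [Nat.card_congr firstRow.toEquiv]
    simp [Nat.card_eq_fintype_card]
  change Nat.card (Set.range _) = _
  rw [Nat.card_range_of_injective hinj, Nat.card_prod, Nat.card_prod, Nat.card_fun, hL]
  simp

theorem mem_normalizer_pGroup {t : GL Idx (ZMod 3)}
    (ht : ∀ u x p, ∃ q ∈ pGroup, pElt u x p * t = t * q) :
    t ∈ normalizer (pGroup : Set (GL Idx (ZMod 3))) := by
  rw [← inv_inv t]
  refine inv_mem (mem_normalizer_fintype ?_)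
  rintro _ ⟨⟨u, x, p⟩, rfl⟩
  obtain ⟨q, hq, h⟩ := ht u x p
  rwa [inv_inv, mul_assoc, h, inv_mul_cancel_left]

theorem G_le_normalizer_pGroup : G ≤ normalizer (pGroup : Set (GL Idx (ZMod 3))) := by
  rw [G, closure_le]
  rintro g (rfl | rfl | rfl | rfl)
  · exact mem_normalizer_pGroup fun u x p => ⟨_, pElt_mem_pGroup _ _ _, pElt_mul_uA u x p⟩
  · exact mem_normalizer_pGroup fun u x p => ⟨_, pElt_mem_pGroup _ _ _, pElt_mul_uB u x p⟩
  · exact le_normalizer uC_mem_pGroup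
  · exact le_normalizer uD_mem_pGroup

theorem rowAct_zero (u : Fin 4 → L) : rowAct u 0 0 = u := by
  ext1 j
  fin_cases j <;> simp [rowAct]

theorem zero_rowAct (y q : L) : rowAct 0 y q = 0 := by
  ext1 j
  fin_cases j <;> simp [rowAct]

theorem rowAct_single_zero (z y q : L) :
    rowAct (Pi.single 0 z) y q =
      Pi.single 0 z + Pi.single 1 (z ^ 27 * y ^ 27) + Pi.single 2 (z ^ 9 * y) +
        Pi.single 3 (z ^ 3 * q ^ 3 + z ^ 27 * (q ^ 9 + y ^ 12 - y ^ 27)) := by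
  ext1 j
  fin_cases j <;> simp [rowAct]

theorem pElt_zero_mul_pElt_zero (x p y q : L) :
    pElt 0 x p * pElt 0 y q = pElt 0 (x + y) (p + q - x * y ^ 27) := by
  rw [pElt_mul_pElt, zero_rowAct, add_zero]

theorem pElt_mul_pElt_zero (u : Fin 4 → L) (x p : L) :
    pElt u 0 0 * pElt 0 x p = pElt (rowAct u x p) x p := by
  simp [pElt_mul_pElt]

theorem pElt_zero_mul_pElt (u : Fin 4 → L) (x p : L) :
    pElt 0 x p * pElt u 0 0 = pElt u x p := by
  simp [pElt_mul_pElt, zero_rowAct]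

theorem conj_uA_pElt (u : Fin 4 → L) (x p : L) :
    uA⁻¹ * pElt u x p * uA = pElt (ζ • u) (ζ ^ 2 * x) (ζ * p) := by
  rw [mul_assoc, pElt_mul_uA, inv_mul_cancel_left]

section Generation

/-- The `x` for which the subgroup `K` contains some `pElt 0 x p`. -/
def fstParams (K : Subgroup (GL Idx (ZMod 3))) : AddSubgroup L where
  carrier := {x | ∃ p, pElt 0 x p ∈ K}
  zero_mem' := ⟨0, pElt_zero ▸ one_mem K⟩
  add_mem' := fun ⟨_, hx⟩ ⟨_, hy⟩ => ⟨_, pElt_zero_mul_pElt_zero _ _ _ _ ▸ mul_mem hx hy⟩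
  neg_mem' := fun ⟨_, hx⟩ => ⟨_, by simpa only [pElt_inv, zero_rowAct, neg_zero] using inv_mem hx⟩

/-- The `p` for which the subgroup `K` contains `pElt 0 0 p`. -/
def sndParams (K : Subgroup (GL Idx (ZMod 3))) : AddSubgroup L where
  carrier := {p | pElt 0 0 p ∈ K}
  zero_mem' := show pElt 0 0 0 ∈ K from pElt_zero ▸ one_mem K
  add_mem' {p q} hp hq := by simpa [pElt_zero_mul_pElt_zero] using K.mul_mem hp hq
  neg_mem' {p} hp := by simpa [pElt_inv, zero_rowAct] using K.inv_mem hp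

/-- The `u` for which the subgroup `K` contains `pElt u 0 0`. -/
def rowParams (K : Subgroup (GL Idx (ZMod 3))) : AddSubgroup (Fin 4 → L) where
  carrier := {u | pElt u 0 0 ∈ K}
  zero_mem' := show pElt 0 0 0 ∈ K from pElt_zero ▸ one_mem K
  add_mem' {u v} hu hv := by
    simpa [pElt_mul_pElt, rowAct_zero, add_comm] using K.mul_mem hu hv
  neg_mem' {u} hu := by simpa [pElt_inv, rowAct_zero] using K.inv_mem hu

variable {K : Subgroup (GL Idx (ZMod 3))}

theorem mem_rowParams {u : Fin 4 → L} : u ∈ rowParams K ↔ pElt u 0 0 ∈ K := .rfl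

theorem fstParams_eq_top (hA : ∀ k ∈ K, uA⁻¹ * k * uA ∈ K) (hC : uC ∈ K) : fstParams K = ⊤ := by
  have hζ2 : ∀ x ∈ fstParams K, ζ ^ 2 * x ∈ fstParams K := by
    rintro x ⟨p, hp⟩
    refine ⟨ζ * p, ?_⟩
    have h := hA _ hp
    rwa [conj_uA_pElt, smul_zero] at h
  refine addSubgroup_eq_top (fun x hx => ?_) isUnit_one ⟨0, uC_eq ▸ hC⟩
  have h : ζ ^ 2 * (ζ ^ 2 * (ζ ^ 2 * x)) = ζ * x := by
    linear_combination ζ * x * ζ_pow_five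
  exact h ▸ hζ2 _ (hζ2 _ (hζ2 _ hx))

theorem sndParams_eq_top (hA : ∀ k ∈ K, uA⁻¹ * k * uA ∈ K) (hC : uC ∈ K) : sndParams K = ⊤ := by
  obtain ⟨p, hp⟩ : ζ ∈ fstParams K := fstParams_eq_top hA hC ▸ AddSubgroup.mem_top ζ
  have hcomm : uC * pElt 0 ζ p = pElt 0 ζ p * uC * pElt 0 0 (ζ - ζ ^ 2) := by
    have hζ27 : ζ ^ 27 = ζ ^ 2 := by
      linear_combination (ζ ^ 22 + ζ ^ 17 + ζ ^ 12 + ζ ^ 7 + ζ ^ 2) * ζ_pow_five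
    rw [uC_eq, pElt_zero_mul_pElt_zero, pElt_zero_mul_pElt_zero, pElt_zero_mul_pElt_zero, pElt_inj]
    refine ⟨rfl, by ring, ?_⟩
    rw [hζ27]
    ring
  have hunit : IsUnit (ζ - ζ ^ 2) := by
    have h := (isUnit_ζ.mul (isUnit_ζ_pow_sub_one (i := 1) (by norm_num))).neg
    convert h using 1
    ring
  refine addSubgroup_eq_top (fun q hq => ?_) hunit ?_
  · have h := hA _ hq
    rwa [conj_uA_pElt, smul_zero, mul_zero] at h
  · have h := K.mul_mem (K.inv_mem (K.mul_mem hp hC)) (K.mul_mem hC hp)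
    rwa [hcomm, inv_mul_cancel_left] at h

theorem pElt_zero_mem (hA : ∀ k ∈ K, uA⁻¹ * k * uA ∈ K) (hC : uC ∈ K) (x p : L) :
    pElt 0 x p ∈ K := by
  obtain ⟨q, hq⟩ : x ∈ fstParams K := fstParams_eq_top hA hC ▸ AddSubgroup.mem_top x
  have hpq : p - q ∈ sndParams K := sndParams_eq_top hA hC ▸ AddSubgroup.mem_top _
  have h := K.mul_mem hq hpq
  rw [pElt_zero_mul_pElt_zero] at h
  simpa using h

theorem rowAct_mem_rowParams {u : Fin 4 → L} {x p : L} (hxp : pElt 0 x p ∈ K)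
    (hu : u ∈ rowParams K) : rowAct u x p ∈ rowParams K := by
  have h : pElt u 0 0 * pElt 0 x p ∈ K := K.mul_mem hu hxp
  rwa [pElt_mul_pElt_zero, ← pElt_zero_mul_pElt, K.mul_mem_cancel_left hxp] at h

theorem single_mem_rowParams (hA : ∀ k ∈ K, uA⁻¹ * k * uA ∈ K) {j : Fin 4} {z : L}
    (hz : IsUnit z) (hzK : Pi.single j z ∈ rowParams K) (w : L) :
    Pi.single j w ∈ rowParams K := by
  have htop : (rowParams K).comap (AddMonoidHom.single (fun _ => L) j) = ⊤ := by
    refine addSubgroup_eq_top (fun x hx => ?_) hz hzK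
    have h : pElt (Pi.single j x) 0 0 ∈ K := hx
    have h' := hA _ h
    rwa [conj_uA_pElt, mul_zero, mul_zero, ← Pi.single_smul', smul_eq_mul] at h'
  exact (AddSubgroup.ext_iff.1 htop w).2 trivial

theorem single_zero_mem_rowParams (hA : ∀ k ∈ K, uA⁻¹ * k * uA ∈ K) (hD : uD ∈ K) (w : L) :
    Pi.single 0 w ∈ rowParams K :=
  single_mem_rowParams hA isUnit_one (by rwa [mem_rowParams, ← uD_eq]) w

theorem single_three_mem_rowParams (hA : ∀ k ∈ K, uA⁻¹ * k * uA ∈ K) (hC : uC ∈ K)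
    (hD : uD ∈ K) (w : L) : Pi.single 3 w ∈ rowParams K := by
  have h2 : IsUnit (2 : L) := .of_mul_eq_one 2 (by linear_combination CharP.cast_eq_zero L 3)
  refine single_mem_rowParams hA h2 ?_ w
  have h0 := single_zero_mem_rowParams hA hD 1
  have h := sub_mem (rowAct_mem_rowParams (pElt_zero_mem hA hC 0 1) h0) h0
  simpa [rowAct_single_zero, one_add_one_eq_two] using h

theorem rowParams_eq_top (hA : ∀ k ∈ K, uA⁻¹ * k * uA ∈ K) (hC : uC ∈ K) (hD : uD ∈ K) :
    rowParams K = ⊤ := by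
  have h0 := single_zero_mem_rowParams hA hD
  have h3 := single_three_mem_rowParams hA hC hD
  have h12 : ∀ z x : L,
      Pi.single 1 (z ^ 27 * x ^ 27) + Pi.single 2 (z ^ 9 * x) ∈ rowParams K := by
    intro z x
    have h := sub_mem (sub_mem (rowAct_mem_rowParams (pElt_zero_mem hA hC x 0) (h0 z)) (h0 z))
      (h3 (z ^ 3 * 0 ^ 3 + z ^ 27 * (0 ^ 9 + x ^ 12 - x ^ 27)))
    rwa [rowAct_single_zero, add_assoc, add_assoc, add_sub_cancel_left, ← add_assoc,
      add_sub_cancel_right] at h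
  have h2 : ∀ w, Pi.single 2 w ∈ rowParams K := by
    refine single_mem_rowParams hA (isUnit_ζ_pow_sub_one (i := 3) (by norm_num)) ?_
    have hζ27 : ζ ^ 27 * (ζ ^ 4) ^ 27 = 1 := by rw [← mul_pow, ← pow_succ', ζ_pow_five, one_pow]
    have hζ9 : ζ ^ 9 * ζ ^ 4 = ζ ^ 3 := by
      linear_combination (ζ ^ 8 + ζ ^ 3) * ζ_pow_five
    have h := sub_mem (h12 ζ (ζ ^ 4)) (h12 1 1)
    rw [hζ27, hζ9] at h
    simpa [← Pi.single_sub] using h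
  have h1 : ∀ w, Pi.single 1 w ∈ rowParams K := by
    refine single_mem_rowParams hA isUnit_one ?_
    simpa using sub_mem (h12 1 1) (h2 1)
  refine eq_top_iff.2 fun u _ => ?_
  rw [← Finset.univ_sum_single u]
  refine sum_mem fun j _ => ?_
  fin_cases j
  exacts [h0 _, h1 _, h2 _, h3 _]

theorem pGroup_le (hA : ∀ k ∈ K, uA⁻¹ * k * uA ∈ K) (hC : uC ∈ K) (hD : uD ∈ K) :
    pGroup ≤ K := by
  rintro _ ⟨⟨u, x, p⟩, rfl⟩
  have hu : u ∈ rowParams K := rowParams_eq_top hA hC hD ▸ AddSubgroup.mem_top u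
  have h := K.mul_mem (pElt_zero_mem hA hC x p) hu
  rwa [pElt_zero_mul_pElt] at h

end Generation

theorem P_map : P.map G.subtype = pGroup := by
  apply le_antisymm
  · have : (pGroup.subgroupOf G).Normal := normal_subgroupOf_of_le_normalizer G_le_normalizer_pGroup
    rw [map_le_iff_le_comap]
    refine normalClosure_le_normal (N := pGroup.subgroupOf G) ?_
    rintro g (rfl | rfl)
    · exact uC_mem_pGroup
    · exact uD_mem_pGroup
  · refine pGroup_le ?_ ⟨gC, subset_normalClosure (by simp), rfl⟩
      ⟨gD, subset_normalClosure (by simp), rfl⟩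
    rintro _ ⟨k, hk, rfl⟩
    exact ⟨gA⁻¹ * k * gA, normalClosure_normal.conj_mem' k hk gA, rfl⟩

theorem mem_P {g : G} : g ∈ P ↔ ∃ u x p, pElt u x p = g := by
  rw [← mem_pGroup, ← P_map]
  exact (mem_map_iff_mem G.subtype_injective).symm

instance P_normal : P.Normal := normalClosure_normal

theorem card_P : Nat.card P = 3 ^ 24 := by
  rw [← card_pGroup, ← P_map, card_map_of_injective G.subtype_injective]

theorem P_isPGroup : IsPGroup 3 P := .of_card card_P

/-! ### The Frobenius group `F` -/

/-- The embedding `X ↦ diag(1, X, X, X, X)`, which maps `a` and `b` to `A` and `B`. -/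
def blockDiagHom : M4 →* Matrix Idx Idx (ZMod 3) where
  toFun X := blockMat 0 (diagonal fun _ => X)
  map_one' := by rw [diagonal_one, blockMat_zero_one]
  map_mul' X Y := by rw [blockMat_zero_mul, diagonal_mul_diagonal]

theorem blockDiagHom_injective : Function.Injective blockDiagHom := fun _ _ h =>
  congrFun (diagonal_injective (blockMat_inj.1 h).2) 0

theorem val_uA : uA.val = blockDiagHom a := rfl

theorem val_uB : uB.val = blockDiagHom b := rfl

theorem uB_mul_uA : uB * uA = uA ^ 3 * uB := by
  refine Units.ext ?_
  rw [Units.val_mul, Units.val_mul, Units.val_pow_eq_pow_val, val_uA, val_uB]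
  simp only [← map_pow, ← map_mul]
  exact congrArg blockDiagHom (by decide +kernel)

theorem orderOf_uA : orderOf uA = 5 := by
  have : Fact (Nat.Prime 5) := ⟨by norm_num⟩
  rw [← orderOf_units, val_uA, orderOf_injective _ blockDiagHom_injective]
  exact orderOf_eq_prime a_pow (by decide +kernel)

theorem orderOf_uB : orderOf uB = 4 := by
  rw [← orderOf_units, val_uB, orderOf_injective _ blockDiagHom_injective]
  exact orderOf_eq_prime_pow (p := 2) (n := 1) (by decide +kernel) b_pow

theorem orderOf_fA : orderOf fA = 5 := by
  rw [← orderOf_coe, ← orderOf_coe]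
  exact orderOf_uA

theorem orderOf_fB : orderOf fB = 4 := by
  rw [← orderOf_coe, ← orderOf_coe]
  exact orderOf_uB

theorem card_zpowers_fA : Nat.card (zpowers fA) = 5 := by rw [Nat.card_zpowers, orderOf_fA]

theorem card_zpowers_fB : Nat.card (zpowers fB) = 4 := by rw [Nat.card_zpowers, orderOf_fB]

theorem isOfFinOrder_fA : IsOfFinOrder fA := orderOf_pos_iff.1 (by rw [orderOf_fA]; norm_num)

theorem isOfFinOrder_fB : IsOfFinOrder fB := orderOf_pos_iff.1 (by rw [orderOf_fB]; norm_num)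

theorem fB_mul_fA : fB * fA = fA ^ 3 * fB := Subtype.ext (Subtype.ext uB_mul_uA)

theorem eq_top_of_fA_mem_of_fB_mem {H : Subgroup F} (hA : fA ∈ H) (hB : fB ∈ H) : H = ⊤ :=
  eq_top_of_forall_generator_mem (S := {gA, gB}) fun s hs => by
    obtain rfl | rfl := hs
    exacts [hA, hB]

instance zpowers_fA_normal : (zpowers fA).Normal := by
  rw [← normalizer_eq_top_iff]
  refine eq_top_of_fA_mem_of_fB_mem (le_normalizer (mem_zpowers fA)) (mem_normalizer_fintype ?_)
  rintro _ ⟨k, rfl⟩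
  change fB * fA ^ k * fB⁻¹ ∈ zpowers fA
  rw [← conj_zpow, fB_mul_fA, mul_inv_cancel_right]
  exact zpow_mem (pow_mem (mem_zpowers fA) 3) k

theorem isComplement'_zpowers : IsComplement' (zpowers fA) (zpowers fB) :=
  isComplement'_of_coprime_of_sup_eq_top (by rw [card_zpowers_fA, card_zpowers_fB]; norm_num)
    (eq_top_of_fA_mem_of_fB_mem (mem_sup_left (mem_zpowers fA)) (mem_sup_right (mem_zpowers fB)))

theorem card_F : Nat.card F = 20 := by
  rw [← isComplement'_zpowers.card_mul_card, card_zpowers_fA, card_zpowers_fB]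

theorem eq_zero_or_eq_zero_of_uB_pow_mul_uA_pow {i j : ℕ} (hi : i < 5) (hj : j < 4)
    (h : uB ^ j * uA ^ i = uA ^ i * uB ^ j) : i = 0 ∨ j = 0 := by
  have hab : ∀ i < 5, ∀ j < 4, b ^ j * a ^ i = a ^ i * b ^ j → i = 0 ∨ j = 0 := by
    decide +kernel
  have h' := congrArg Units.val h
  rw [Units.val_mul, Units.val_mul, Units.val_pow_eq_pow_val, Units.val_pow_eq_pow_val, val_uA,
    val_uB] at h'
  simp only [← map_pow, ← map_mul] at h'
  exact hab i hi j hj (blockDiagHom_injective h')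

theorem F_isFrobenius : IsFrobenius (zpowers fA) (zpowers fB) where
  normal := zpowers_fA_normal
  isComplement := isComplement'_zpowers
  kernel_ne_bot h := by simpa [h] using card_zpowers_fA
  complement_ne_bot h := by simpa [h] using card_zpowers_fB
  fixedPointFree h hh h1 k hk hc := by
    obtain ⟨i, hi, rfl⟩ := exists_pow_eq_of_mem_zpowers isOfFinOrder_fA hk
    obtain ⟨j, hj, rfl⟩ := exists_pow_eq_of_mem_zpowers isOfFinOrder_fB hh
    rw [orderOf_fA] at hi
    rw [orderOf_fB] at hj
    have hGL := congrArg (fun f : F => ((f : G) : GL Idx (ZMod 3))) hc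
    obtain rfl | rfl := eq_zero_or_eq_zero_of_uB_pow_mul_uA_pow hi hj hGL
    · exact pow_zero fA
    · exact absurd (pow_zero fB) h1

/-! ### The semidirect product `G = P ⋊ F` -/

theorem P_isComplement' : IsComplement' P F := by
  refine isComplement'_of_coprime_of_sup_eq_top (by rw [card_P, card_F]; norm_num)
    (eq_top_of_forall_generator_mem fun s hs => ?_)
  obtain rfl | rfl | rfl | rfl := hs
  · exact mem_sup_right (subset_closure (.inl rfl))
  · exact mem_sup_right (subset_closure (.inr rfl))
  · exact mem_sup_left (subset_normalClosure (.inl rfl))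
  · exact mem_sup_left (subset_normalClosure (.inr rfl))

theorem card_G : Nat.card G = 2 ^ 2 * 3 ^ 24 * 5 := by
  rw [← P_isComplement'.card_mul_card, card_P, card_F]
  norm_num

theorem le_P_of_isPGroup {N : Subgroup G} (hN : IsPGroup 3 N) : N ≤ P :=
  le_of_isPGroup_of_coprime_index
    (by rw [P_isComplement'.symm.index_eq_card, card_F]; norm_num) hN

theorem G_isSolvable : Group.IsSolvable G := by
  have : Fact (Nat.Prime 3) := ⟨Nat.prime_three⟩
  have : Group.IsNilpotent P := P_isPGroup.isNilpotent
  have : Group.IsSolvable F := isSolvable_of_isComplement' isComplement'_zpowers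
  exact isSolvable_of_isComplement' P_isComplement'

/-! ### The element orders of `G` -/

theorem P_pow_nine {g : G} (hg : g ∈ P) : g ^ 9 = 1 := by
  obtain ⟨u, x, p, h⟩ := mem_P.1 hg
  have h9 := pElt_pow_nine u x p
  rw [h] at h9
  exact Subtype.ext h9

theorem exists_mem_P_orderOf_eq_nine : ∃ g ∈ P, orderOf g = 9 := by
  have : Fact (Nat.Prime 3) := ⟨Nat.prime_three⟩
  have hζ : ζ ^ 27 ≠ ζ ^ 3 := fun h => by
    have hunit := (isUnit_ζ.pow 2).mul (isUnit_ζ_pow_sub_one (i := 1) (by norm_num))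
    refine hunit.ne_zero ?_
    linear_combination -h + (ζ ^ 22 + ζ ^ 17 + ζ ^ 12 + ζ ^ 7 + ζ ^ 2) * ζ_pow_five
  obtain ⟨g, hg, h⟩ : pElt (Pi.single 0 ζ) 1 0 ∈ P.map G.subtype := by
    rw [P_map]
    exact pElt_mem_pGroup _ _ _
  refine ⟨g, hg, orderOf_eq_prime_pow (p := 3) (n := 1) (fun h3 => hζ ?_) (P_pow_nine hg)⟩
  have h3' := congrArg G.subtype h3
  rw [pow_one, map_pow, map_one, h, pElt_pow_three, ← pElt_zero, pElt_inj] at h3'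
  simpa [sub_eq_zero] using congrFun h3'.1 3

theorem P_exponent : Monoid.exponent P = 9 := by
  refine Nat.dvd_antisymm ?_ ?_
  · exact Monoid.exponent_dvd_of_forall_pow_eq_one fun g => Subtype.ext (P_pow_nine g.2)
  · obtain ⟨g, hg, h⟩ := exists_mem_P_orderOf_eq_nine
    rw [← h, ← orderOf_mk g hg]
    exact Monoid.order_dvd_exponent _

theorem pElt_mul_uA_pow (u : Fin 4 → L) (x p : L) (i : ℕ) :
    pElt u x p * uA ^ i = uA ^ i * pElt (ζ ^ i • u) ((ζ ^ 2) ^ i * x) (ζ ^ i * p) := by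
  induction i with
  | zero => simp
  | succ i ih =>
    rw [pow_succ, ← mul_assoc, ih, mul_assoc, pElt_mul_uA, ← mul_assoc, smul_smul, ← mul_assoc,
      ← mul_assoc, ← pow_succ', ← pow_succ']

theorem eq_one_of_commute_gA_pow {i : ℕ} (hi : ¬5 ∣ i) {g : G} (hg : g ∈ P)
    (h : gA ^ i * g = g * gA ^ i) : g = 1 := by
  obtain ⟨u, x, p, hg⟩ := mem_P.1 hg
  have h' := congrArg G.subtype h
  rw [map_mul, map_mul, map_pow, subtype_apply, subtype_apply, ← hg] at h'
  change uA ^ i * pElt u x p = pElt u x p * uA ^ i at h'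
  rw [pElt_mul_uA_pow, mul_left_cancel_iff, pElt_inj] at h'
  have hfix : ∀ {n : ℕ} {z : L}, ¬5 ∣ n → z = ζ ^ n * z → z = 0 := fun hn hz =>
    (isUnit_ζ_pow_sub_one hn).mul_right_eq_zero.1 (by linear_combination -hz)
  obtain ⟨hu, hx, hp⟩ := h'
  have hu0 : u = 0 := funext fun j => hfix hi (congrFun hu j)
  have hx0 : x = 0 := hfix (n := 2 * i) (by omega) (by rwa [pow_mul])
  have hp0 : p = 0 := hfix hi hp
  refine Subtype.ext ?_
  rw [← hg, hu0, hx0, hp0, pElt_zero, Subgroup.coe_one]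

theorem mul_gA_pow_pow_five {i : ℕ} (hi : ¬5 ∣ i) {g : G} (hg : g ∈ P) : (g * gA ^ i) ^ 5 = 1 := by
  have h5 : gA ^ 5 = 1 := Subtype.ext (orderOf_dvd_iff_pow_eq_one.1 orderOf_uA.dvd)
  have hconj : IsConj (gA ^ i) (g * gA ^ i) :=
    isConj_mul_of_fixedPointFree (fun _ => eq_one_of_commute_gA_pow hi) hg
  have := hconj.pow 5
  rwa [← pow_mul, mul_comm, pow_mul, h5, one_pow, isConj_one_right] at this

theorem uB_pow_four : uB ^ 4 = 1 := orderOf_dvd_iff_pow_eq_one.1 orderOf_uB.dvd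

theorem pElt_mul_uB_sq (u : Fin 4 → L) (x p : L) :
    pElt u x p * uB ^ 2 = uB ^ 2 * pElt (u ^ 9) (x ^ 9) (p ^ 9) := by
  have h729 : ∀ z : L, (z ^ 27) ^ 27 = z ^ 9 := fun z => by
    rw [← pow_mul]
    exact L.pow_add_mul_eighty z (by norm_num) 9
  have hu : (u ^ 27) ^ 27 = u ^ 9 := funext fun j => h729 (u j)
  rw [pow_two, ← mul_assoc, pElt_mul_uB, mul_assoc, pElt_mul_uB, hu, h729, h729, mul_assoc]

/-- Since `B ^ 2` acts on the parameters as the involution `z ↦ z ^ 9`, the square of an element of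
the coset lies in `P` and has parameters `u 0` and `x` fixed by that involution, so its cube is
trivial. -/
theorem pElt_mul_uB_sq_pow_six (u : Fin 4 → L) (x p : L) : (pElt u x p * uB ^ 2) ^ 6 = 1 := by
  have h81 : ∀ z : L, (z ^ 9) ^ 9 = z := fun z => by rw [← pow_mul, L.pow_card]
  have hsq : (pElt u x p * uB ^ 2) ^ 2 = pElt u x p * pElt (u ^ 9) (x ^ 9) (p ^ 9) := by
    have huB : uB ^ 2 * uB ^ 2 = 1 := by rw [← pow_add, uB_pow_four]
    rw [pow_two]
    nth_rewrite 2 [pElt_mul_uB_sq]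
    rw [mul_assoc, ← mul_assoc (uB ^ 2), huB, one_mul]
  have hfix : ∀ z : L, (z ^ 9 + z) ^ 9 = z ^ 9 + z := fun z => by
    rw [L.add_pow_nine, h81, add_comm]
  have hcube : ∀ v y : L, v ^ 9 = v → y ^ 9 = y → v ^ 27 * y ^ 12 - v ^ 3 * y ^ 4 = 0 := by
    intro v y hv hy
    have hv' : v ^ 27 = v ^ 3 := by rw [show 27 = 9 * 3 by rfl, pow_mul, hv]
    linear_combination y ^ 12 * hv' + v ^ 3 * y ^ 3 * hy
  rw [show 6 = 2 * 3 by rfl, pow_mul, hsq, pElt_mul_pElt, pElt_pow_three, ← pElt_zero, pElt_inj]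
  refine ⟨?_, rfl, rfl⟩
  have hv : (u ^ 9 + rowAct u (x ^ 9) (p ^ 9)) 0 = u 0 ^ 9 + u 0 := rfl
  rw [hv, add_comm x, hcube _ _ (hfix (u 0)) (hfix x), Pi.single_zero]

theorem mul_gB_sq_pow_six {g : G} (hg : g ∈ P) : (g * gB ^ 2) ^ 6 = 1 := by
  obtain ⟨u, x, p, h⟩ := mem_P.1 hg
  have := pElt_mul_uB_sq_pow_six u x p
  rw [h] at this
  exact Subtype.ext this

theorem mul_gB_pow_pow_twelve {j : ℕ} (hj : ¬4 ∣ j) {g : G} (hg : g ∈ P) :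
    (g * gB ^ j) ^ 12 = 1 := by
  have hgB : gB ^ 4 = 1 := Subtype.ext uB_pow_four
  have hmod : ∀ {n : ℕ}, n % 4 = 2 → gB ^ n = gB ^ 2 := fun {n} hn => by
    rw [pow_eq_pow_mod n hgB, hn]
  rw [show 12 = 2 * 6 by rfl, pow_mul]
  obtain hj2 | hj2 : j % 4 = 2 ∨ j % 2 = 1 := by omega
  · rw [hmod hj2, pow_right_comm, mul_gB_sq_pow_six hg, one_pow]
  · have hsq : (g * gB ^ j) ^ 2 = g * (gB ^ j * g * (gB ^ j)⁻¹) * gB ^ 2 := by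
      rw [← hmod (n := j + j) (by omega), pow_add, pow_two]
      simp only [mul_assoc, inv_mul_cancel_left]
    rw [hsq]
    exact mul_gB_sq_pow_six (P.mul_mem hg (P_normal.conj_mem g hg _))

theorem exists_isConj_mul_gB_pow {i j : ℕ} (hj : ¬4 ∣ j) {g : G} (hg : g ∈ P) :
    ∃ h ∈ P, IsConj (h * gB ^ j) (g * (gA ^ i * gB ^ j)) := by
  have hfB : fB ^ j ≠ 1 := by rwa [Ne, ← orderOf_dvd_iff_pow_eq_one, orderOf_fB]
  have hconj : IsConj (fB ^ j) (fA ^ i * fB ^ j) :=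
    isConj_mul_of_fixedPointFree
      (F_isFrobenius.fixedPointFree _ (pow_mem (mem_zpowers fB) j) hfB) (pow_mem (mem_zpowers fA) i)
  obtain ⟨c, hc⟩ := isConj_iff.1 (F.subtype.map_isConj hconj)
  refine ⟨c⁻¹ * g * c, P_normal.conj_mem' g hg c, isConj_iff.2 ⟨c, ?_⟩⟩
  change c * gB ^ j * c⁻¹ = gA ^ i * gB ^ j at hc
  rw [← hc]
  group

theorem exists_pow_eq_one (g : G) : ∃ n ∈ ({5, 9, 12} : Set ℕ), g ^ n = 1 := by
  obtain ⟨⟨⟨p, hp⟩, f⟩, rfl⟩ := P_isComplement'.2 g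
  obtain ⟨⟨⟨x, hx⟩, ⟨y, hy⟩⟩, rfl⟩ := isComplement'_zpowers.2 f
  obtain ⟨i, hi, rfl⟩ := exists_pow_eq_of_mem_zpowers isOfFinOrder_fA hx
  obtain ⟨j, hj, rfl⟩ := exists_pow_eq_of_mem_zpowers isOfFinOrder_fB hy
  rw [orderOf_fA] at hi
  rw [orderOf_fB] at hj
  change ∃ n ∈ _, (p * (gA ^ i * gB ^ j)) ^ n = 1
  obtain rfl | hj0 := Nat.eq_zero_or_pos j
  · rw [pow_zero, mul_one]
    obtain rfl | hi0 := Nat.eq_zero_or_pos i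
    · exact ⟨9, by simp, by rw [pow_zero, mul_one, P_pow_nine hp]⟩
    · exact ⟨5, by simp, mul_gA_pow_pow_five (Nat.not_dvd_of_pos_of_lt hi0 hi) hp⟩
  · have hj4 := Nat.not_dvd_of_pos_of_lt hj0 hj
    obtain ⟨q, hq, hconj⟩ := exists_isConj_mul_gB_pow (i := i) hj4 hp
    have := hconj.pow 12
    rw [mul_gB_pow_pow_twelve hj4 hq, isConj_one_right] at this
    exact ⟨12, by simp, this⟩

theorem orderOf_uC : orderOf uC = 3 := by
  have : Fact (Nat.Prime 3) := ⟨Nat.prime_three⟩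
  refine orderOf_eq_prime ?_ fun h => ?_
  · rw [uC_eq, pElt_pow_three]
    simp [pElt_zero]
  · rw [uC_eq, ← pElt_zero, pElt_inj] at h
    exact one_ne_zero h.2.1

theorem commute_uC_uB : Commute uC uB := by
  rw [Commute, SemiconjBy, uC_eq, pElt_mul_uB]
  simp

theorem orderOf_uC_mul_uB : orderOf (uC * uB) = 12 := by
  have hcop : (orderOf uC).Coprime (orderOf uB) := by rw [orderOf_uC, orderOf_uB]; norm_num
  have h : orderOf (uC * uB) = orderOf uC * orderOf uB := by
    apply Commute.orderOf_mul_eq_mul_orderOf_of_coprime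
    · exact commute_uC_uB
    · exact hcop
  rw [h, orderOf_uC, orderOf_uB]

theorem orderOf_gC_mul_gB : orderOf (gC * gB) = 12 := by
  rw [← Subgroup.orderOf_coe]
  exact orderOf_uC_mul_uB

theorem orderOf_gA : orderOf gA = 5 := by
  rw [← Subgroup.orderOf_coe]
  exact orderOf_uA

theorem subset_elementOrders_G : {5, 9, 12} ⊆ elementOrders G := by
  rintro _ (rfl | rfl | rfl)
  · exact ⟨gA, orderOf_gA⟩
  · obtain ⟨g, -, hg⟩ := exists_mem_P_orderOf_eq_nine
    exact ⟨g, hg⟩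
  · exact ⟨gC * gB, orderOf_gC_mul_gB⟩

theorem elementOrders_G : elementOrders G = {m | ∃ n ∈ ({5, 9, 12} : Set ℕ), m ∣ n} :=
  elementOrders_eq_setOf_dvd (by simp) subset_elementOrders_G exists_pow_eq_one

theorem isAntichain_dvd : IsAntichain (· ∣ ·) ({5, 9, 12} : Set ℕ) := by
  rintro _ (rfl | rfl | rfl) _ (rfl | rfl | rfl) <;> simp

end SolvIso

theorem proposition3p1 :
    -- `G` is solvable, of the stated order, and isospectral to `S₄(3)`
    Group.IsSolvable SolvIso.G ∧
    Nat.card SolvIso.G = 2 ^ 2 * 3 ^ 24 * 5 ∧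
    SolvIso.Isospectral SolvIso.G SolvIso.S43 ∧
    SolvIso.maxElementOrders SolvIso.S43 = {5, 9, 12} ∧
    -- `G` is the semidirect product of its normal subgroup `P` by `F`
    SolvIso.P.Normal ∧
    Subgroup.IsComplement' SolvIso.P SolvIso.F ∧
    -- `P` is the largest normal `3`-subgroup, of exponent `9` and order `3 ^ 24`
    IsPGroup 3 SolvIso.P ∧
    (∀ N : Subgroup SolvIso.G, N.Normal → IsPGroup 3 N → N ≤ SolvIso.P) ∧
    Monoid.exponent SolvIso.P = 9 ∧
    Nat.card SolvIso.P = 3 ^ 24 ∧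
    -- `F` is a Frobenius group with cyclic kernel of order `5` and cyclic complement of order `4`
    SolvIso.IsFrobenius (Subgroup.zpowers SolvIso.fA) (Subgroup.zpowers SolvIso.fB) ∧
    Nat.card (Subgroup.zpowers SolvIso.fA) = 5 ∧
    Nat.card (Subgroup.zpowers SolvIso.fB) = 4 :=
  ⟨SolvIso.G_isSolvable, SolvIso.card_G,
    SolvIso.elementOrders_G.trans SolvIso.elementOrders_S43.symm,
    SolvIso.maxElementOrders_eq_of_isAntichain SolvIso.isAntichain_dvd SolvIso.elementOrders_S43,
    SolvIso.P_normal, SolvIso.P_isComplement', SolvIso.P_isPGroup,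
    fun _ _ hN => SolvIso.le_P_of_isPGroup hN, SolvIso.P_exponent, SolvIso.card_P,
    SolvIso.F_isFrobenius, SolvIso.card_zpowers_fA, SolvIso.card_zpowers_fB⟩
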